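/- \textbf{Theorem.} A \emph{Cantor system} is a pair $(X,G)$, where $X$ is a Cantor set (a space homeomorphic to $\{0,1\}^{\mathbb N}$) and $G$ is an arbitrary (not necessarily countable) subgroup of the group $\mathrm{Homeo}(X)$ of all homeomorphisms of $X$. For $x\in X$ let $\mathrm{Orb}_G(x)=\{g(x): g\in G\}$. The \emph{full group} of $G$ is $$[G]=\{\gamma\in \mathrm{Homeo}(X): \gamma(x)\in \mathrm{Orb}_G(x)\text{ for all }x\in X\}.$$ Two Cantor systems $(X_1,G_1)$ and $(X_2,G_2)$ are \emph{orbit equivalent} if there is a homeomorphism $\Lambda:X_1\to X_2$ with $\Lambda(\mathrm{Orb}_{G_1}(x))=\mathrm{Orb}_{G_2}(\Lambda(x))$ for all $x\in X_1$. For $\gamma\in\mathrm{Homeo}(X)$ put $\mathrm{spr}(\gamma)=\mathrm{int}\,\overline{\{x\in X:\gamma(x)\ne x\}}$. A set $A\subset X$ is \emph{regular open} if $A=\mathrm{int}(\overline A)$. A subgroup $\Gamma\subset \mathrm{Homeo}(X)$ \emph{has many involutions} if for every nonempty regular open set $A\subset X$ there is an involution (an element of order exactly two) $\pi\in\Gamma$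 with $\mathrm{spr}(\pi)\subset A$. Let $(X_1,G_1)$ and $(X_2,G_2)$ be Cantor systems such that, for $i=1,2$, every $G_i$-orbit contains at least three points and the full group $[G_i]$ has many involutions. Then $(X_1,G_1)$ and $(X_2,G_2)$ are orbit equivalent if and only if $[G_1]$ and $[G_2]$ are isomorphic as abstract groups. Furthermore, for every group isomorphism $\alpha:[G_1]\to[G_2]$ there is a homeomorphism $\Lambda:X_1\to X_2$ such that $\alpha(g)=\Lambda g\Lambda^{-1}$ for all $g\in[G_1]$. -/

import Mathlib

/-- `X` is a Cantor set: it is homeomorphic to the Cantor space `{0,1}^ℕ`. -/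
def IsCantorSet (X : Type*) [TopologicalSpace X] : Prop :=
  Nonempty (X ≃ₜ (ℕ → Bool))

namespace CantorSystem

variable {X Y : Type*} [TopologicalSpace X] [TopologicalSpace Y]

/-- The orbit `{g x | g ∈ G}` of a point under a group of homeomorphisms. -/
def orbit (G : Subgroup (X ≃ₜ X)) (x : X) : Set X :=
  {y | ∃ g ∈ G, g x = y}

/-- The full group `[G]`: all homeomorphisms `γ` of `X` with `γ x` in the `G`-orbit of `x`, for
every `x`. It is a subgroup of the group `X ≃ₜ X`, whose product is composition. -/
def fullGroup (G : Subgroup (X ≃ₜ X)) : Subgroup (X ≃ₜ X) where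
  carrier := {γ | ∀ x, γ x ∈ orbit G x}
  one_mem' := fun _ => ⟨1, G.one_mem, rfl⟩
  mul_mem' := by
    intro a b ha hb x
    obtain ⟨g, hg, hgx⟩ := hb x
    obtain ⟨h, hh, hhx⟩ := ha (b x)
    refine ⟨h * g, G.mul_mem hh hg, ?_⟩
    change h (g x) = a (b x)
    rw [hgx, hhx]
  inv_mem' := by
    intro a ha x
    obtain ⟨g, hg, hgx⟩ := ha (a.symm x)
    refine ⟨g⁻¹, G.inv_mem hg, ?_⟩
    change g.symm x = a.symm x
    rw [g.symm_apply_eq, hgx, a.apply_symm_apply]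

/-- The two systems are orbit equivalent: some homeomorphism `Λ : X → Y` maps the `G`-orbit of
every point `x` onto the `H`-orbit of `Λ x`. -/
def OrbitEquivalent (G : Subgroup (X ≃ₜ X)) (H : Subgroup (Y ≃ₜ Y)) : Prop :=
  ∃ Λ : X ≃ₜ Y, ∀ x, Λ '' orbit G x = orbit H (Λ x)

/-- The (regular open) support `int (closure {x | γ x ≠ x})` of a homeomorphism. -/
def spr (γ : X ≃ₜ X) : Set X :=
  interior (closure {x | γ x ≠ x})

/-- `A` is regular open: `A = int (closure A)`. -/
def IsRegularOpen (A : Set X) : Prop :=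
  interior (closure A) = A

/-- `Γ` has many involutions: every nonempty regular open set `A` contains the support of some
involution (element of order exactly two) of `Γ`. -/
def HasManyInvolutions (Γ : Subgroup (X ≃ₜ X)) : Prop :=
  ∀ A : Set X, IsRegularOpen A → A.Nonempty → ∃ π ∈ Γ, orderOf π = 2 ∧ spr π ⊆ A

end CantorSystem

/-!
An isomorphism between two full groups is reconstructed as a homeomorphism in two stages.

**Supports.** Write `moved X g` for the open set of points not fixed by `g`. When every nonempty open
set contains the support of an involution, the relation `moved X h ⊆ closure (moved X f)` is
expressible in the language of groups (`HasLocalInvolutions.moved_subset_closure_iff`): it says that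
`h` commutes with `g ^ 12` for every `g` that is algebraically disjoint from `f` in Rubin's sense.
Here disjoint supports imply algebraic disjointness, algebraic disjointness of `f` and `g` forces the
supports of `f` and `g ^ 12` to be disjoint by a pigeonhole argument, and elements with nontrivial
twelfth power exist with arbitrarily small support. Hence an isomorphism `α` preserves disjointness
of supports (`HasLocalInvolutions.disjoint_moved_map`).

**Points.** Call `x` and `y` corresponding if there are nontrivial `g` with support arbitrarily close
to `x` for which `α g` has support arbitrarily close to `y`. Compactness gives every point a
corresponding one (`exists_corresponds`). Uniqueness is where the orbit condition enters. For a clopen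
set `D` of the target, let `A` and `B` be the unions of the supports of those `g` for which `α g` is
supported in `D`, respectively in its complement; these are open and `A ∪ B` is dense. If `x` lies in
both closures and an involution `τ` moves `x`, then, since `α τ` may be cut off outside a clopen
invariant set without leaving the full group, `τ` has to interchange `A` and `B` near `x`
(`exists_isOpen_trace_compl_displaced`). Three points of an orbit cannot be pairwise interchanged in
this way, so the closures are disjoint (`disjoint_closure_trace`). The correspondence is therefore
the graph of an equivariant bijection, and the preimage of a clopen set is open.

An equivariant homeomorphism carries orbits to orbits because a group and its full group have the
same orbits; conversely, an orbit equivalence conjugates one full group onto the other.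
-/

namespace CantorSystem

open Set Topology
open scoped commutatorElement

/-! ### Supports of group elements -/

section MovedSet

variable {Γ X : Type*} [Group Γ] [MulAction Γ X]

variable (X) in
/-- The set of points of `X` that `g` does not fix. -/
def moved (g : Γ) : Set X := {x | g • x ≠ x}

theorem mem_moved {g : Γ} {x : X} : x ∈ moved X g ↔ g • x ≠ x := Iff.rfl

theorem notMem_moved {g : Γ} {x : X} : x ∉ moved X g ↔ g • x = x := not_not

theorem moved_inv (g : Γ) : moved X g⁻¹ = moved X g := by
  ext x
  rw [mem_moved, mem_moved, ne_eq, ne_eq, inv_smul_eq_iff, eq_comm]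

theorem inv_smul_mem_moved_iff {g h : Γ} {x : X} :
    h⁻¹ • x ∈ moved X g ↔ x ∈ moved X (h * g * h⁻¹) := by
  simp only [mem_moved, ne_eq, mul_smul, smul_eq_iff_eq_inv_smul h]

theorem smul_mem_moved_of_commute {g h : Γ} (hc : Commute g h) {x : X} (hx : x ∈ moved X g) :
    h • x ∈ moved X g := by
  rw [mem_moved, ← mul_smul, hc.eq, mul_smul]
  exact fun e => hx (smul_left_cancel h e)

theorem smul_mem_moved_self {g : Γ} {x : X} (hx : x ∈ moved X g) : g • x ∈ moved X g :=
  smul_mem_moved_of_commute (Commute.refl g) hx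

theorem moved_pow_subset (g : Γ) (n : ℕ) : moved X (g ^ n) ⊆ moved X g := by
  intro x hx
  by_contra h
  rw [notMem_moved] at h
  refine hx ?_
  induction n with
  | zero => rw [pow_zero, one_smul]
  | succ n ih =>
    by_contra h'
    rw [pow_succ, mul_smul, h] at h'
    exact h' (ih h')

theorem moved_mul_subset (g h : Γ) : moved X (g * h) ⊆ moved X g ∪ moved X h := by
  intro x hx
  by_contra hn
  rw [mem_union, not_or, notMem_moved, notMem_moved] at hn
  exact hx (by rw [mul_smul, hn.2, hn.1])

/-- A commutator `⁅a, b⁆` is supported in the union of the supports of `b` and of its conjugate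
under `a`. -/
theorem mem_moved_commutator {a b : Γ} {x : X} (hx : x ∈ moved X ⁅a, b⁆) :
    x ∈ moved X b ∨ a⁻¹ • x ∈ moved X b := by
  by_contra hn
  rw [not_or, ← moved_inv b, notMem_moved, moved_inv, notMem_moved] at hn
  refine hx ?_
  rw [commutatorElement_def, mul_smul, hn.1, mul_smul, mul_smul, hn.2, smul_inv_smul]

theorem eq_one_of_forall_notMem_moved [FaithfulSMul Γ X] {g : Γ} (h : ∀ x, x ∉ moved X g) :
    g = 1 :=
  FaithfulSMul.eq_of_smul_eq_smul (α := X) fun x => by rw [notMem_moved.1 (h x), one_smul]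

variable (X) in
theorem moved_nonempty [FaithfulSMul Γ X] {g : Γ} (h : g ≠ 1) : (moved X g).Nonempty := by
  by_contra hn
  exact h (eq_one_of_forall_notMem_moved fun x hx => hn ⟨x, hx⟩)

theorem ne_one_of_mem_moved {g : Γ} {x : X} (h : x ∈ moved X g) : g ≠ 1 := by
  rintro rfl
  exact h (one_smul _ _)

theorem commute_of_disjoint_moved [FaithfulSMul Γ X] {g h : Γ}
    (hd : ∀ x ∈ moved X g, x ∉ moved X h) : Commute g h := by
  refine FaithfulSMul.eq_of_smul_eq_smul (α := X) fun x => ?_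
  by_cases hg : x ∈ moved X g
  · rw [mul_smul, mul_smul, notMem_moved.1 (hd x hg),
      notMem_moved.1 (hd _ (smul_mem_moved_self hg))]
  · by_cases hh : x ∈ moved X h
    · have h1 : h • x ∉ moved X g := fun h' => hd _ h' (smul_mem_moved_self hh)
      rw [mul_smul, mul_smul, notMem_moved.1 hg, notMem_moved.1 h1]
    · rw [notMem_moved] at hg hh
      rw [mul_smul, mul_smul, hg, hh, hg]

/-- If `h` maps the support of `g ≠ 1` off itself, then `g` and `h` do not commute. -/
theorem not_commute_of_displaces [FaithfulSMul Γ X] {g h : Γ} (hg : g ≠ 1) {V : Set X}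
    (hV : moved X g ⊆ V) (hd : ∀ x ∈ V, h • x ∉ V) : ¬ Commute g h := by
  intro hc
  obtain ⟨x, hx⟩ := moved_nonempty X hg
  exact hd x (hV hx) (hV (smul_mem_moved_of_commute hc hx))

variable [TopologicalSpace X] [T2Space X] [ContinuousConstSMul Γ X]

variable (X) in
theorem isOpen_moved (g : Γ) : IsOpen (moved X g) :=
  isOpen_ne_fun (continuous_const_smul g) continuous_id

/-- An open neighbourhood displaced by each of finitely many elements that move the point. -/
theorem exists_isOpen_displaced {x : X} (s : Finset Γ) (hs : ∀ g ∈ s, x ∈ moved X g)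
    {U : Set X} (hU : IsOpen U) (hx : x ∈ U) :
    ∃ V ⊆ U, IsOpen V ∧ x ∈ V ∧ ∀ g ∈ s, ∀ y ∈ V, g • y ∉ V := by
  classical
  induction s using Finset.induction_on with
  | empty => exact ⟨U, Subset.rfl, hU, hx, by simp⟩
  | insert g s _ ih =>
    obtain ⟨V, hVU, hV, hxV, hVs⟩ := ih fun g hg => hs g (Finset.mem_insert_of_mem hg)
    obtain ⟨A, B, hA, hB, hgA, hxB, hAB⟩ := t2_separation (hs g (Finset.mem_insert_self _ _))
    refine ⟨V ∩ (B ∩ (fun y => g • y) ⁻¹' A), inter_subset_left.trans hVU,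
      hV.inter (hB.inter (hA.preimage (continuous_const_smul g))), ⟨hxV, hxB, hgA⟩, ?_⟩
    intro k hk y hy hky
    rcases Finset.mem_insert.1 hk with rfl | hk
    · exact Set.disjoint_left.1 hAB hy.2.2 hky.2.1
    · exact hVs k hk y hy.1 hky.1

end MovedSet

/-! ### Elements with small support -/

section LocalInvolutions

variable {Γ X : Type*} [Group Γ] [MulAction Γ X] [TopologicalSpace X]

variable (Γ X) in
/-- Every nonempty open set contains the support of a nontrivial involution of `Γ`. -/
def HasLocalInvolutions : Prop :=
  ∀ V : Set X, IsOpen V → V.Nonempty → ∃ p : Γ, p ≠ 1 ∧ p * p = 1 ∧ moved X p ⊆ V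

variable [T2Space X] [ContinuousConstSMul Γ X] [FaithfulSMul Γ X]

theorem HasLocalInvolutions.exists_not_commute (hΓ : HasLocalInvolutions Γ X) {V : Set X}
    (hV : IsOpen V) (hne : V.Nonempty) :
    ∃ a b : Γ, moved X a ⊆ V ∧ moved X b ⊆ V ∧ ¬ Commute a b := by
  obtain ⟨p, hp, -, hpV⟩ := hΓ V hV hne
  obtain ⟨x, hx⟩ := moved_nonempty X hp
  obtain ⟨W, hWV, hW, hxW, hd⟩ := exists_isOpen_displaced {p} (by simpa using hx) hV (hpV hx)
  obtain ⟨q, hq, -, hqW⟩ := hΓ W hW ⟨x, hxW⟩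
  exact ⟨q, p, hqW.trans hWV, hpV, not_commute_of_displaces hq hqW (hd p (by simp))⟩

/-- Elements of order `2 ^ (n + 1)` exist with arbitrarily small support: if an involution `p`
displaces the support of `c`, then `(p * c) ^ 2` is the product of `c` and its disjointly supported
conjugate under `p`, so `p * c` has twice the order of `c`. -/
theorem HasLocalInvolutions.exists_order (hΓ : HasLocalInvolutions Γ X) (n : ℕ) :
    ∀ V : Set X, IsOpen V → V.Nonempty →
      ∃ c : Γ, c ^ 2 ^ n ≠ 1 ∧ c ^ 2 ^ (n + 1) = 1 ∧ moved X c ⊆ V := by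
  induction n with
  | zero =>
    intro V hV hne
    obtain ⟨p, hp, hpp, hpV⟩ := hΓ V hV hne
    exact ⟨p, by simpa using hp, by simpa [sq] using hpp, hpV⟩
  | succ n ih =>
    intro V hV hne
    obtain ⟨p, hp, hpp, hpV⟩ := hΓ V hV hne
    have hpi : p⁻¹ = p := inv_eq_of_mul_eq_one_left hpp
    obtain ⟨x, hx⟩ := moved_nonempty X hp
    obtain ⟨W, hWV, hW, hxW, hd⟩ := exists_isOpen_displaced {p} (by simpa using hx) hV (hpV hx)
    obtain ⟨c, hc, hc', hcW⟩ := ih W hW ⟨x, hxW⟩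
    have hdis : ∀ y ∈ moved X c, y ∉ moved X (p * c * p⁻¹) := by
      intro y hy hy'
      rw [← inv_smul_mem_moved_iff, hpi] at hy'
      exact hd p (by simp) y (hcW hy) (hcW hy')
    have hcomm := commute_of_disjoint_moved hdis
    have hsq : (p * c) ^ 2 = (p * c * p⁻¹) * c := by rw [hpi, sq, ← mul_assoc]
    have hpow : ∀ m, (p * c) ^ 2 ^ (m + 1) = (p * c ^ 2 ^ m * p⁻¹) * c ^ 2 ^ m := by
      intro m
      rw [pow_succ' 2 m, pow_mul, hsq, hcomm.symm.mul_pow, conj_pow]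
    refine ⟨p * c, ?_, ?_, ?_⟩
    · obtain ⟨y, hy⟩ := moved_nonempty X hc
      have hyW := moved_pow_subset c _ hy
      refine ne_one_of_mem_moved (x := y) ?_
      rw [hpow, mem_moved, mul_smul]
      have h1 : c ^ 2 ^ n • y ∉ moved X (p * c ^ 2 ^ n * p⁻¹) := by
        rw [← conj_pow]
        exact fun h => hdis _ (moved_pow_subset c _ (smul_mem_moved_self hy))
          (moved_pow_subset _ _ h)
      rwa [notMem_moved.1 h1]
    · rw [hpow, hc', mul_one, mul_one, mul_inv_cancel]
    · exact (moved_mul_subset p c).trans (union_subset hpV (hcW.trans hWV))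

theorem HasLocalInvolutions.exists_pow_twelve_ne_one (hΓ : HasLocalInvolutions Γ X) {V : Set X}
    (hV : IsOpen V) (hne : V.Nonempty) : ∃ c : Γ, c ^ 12 ≠ 1 ∧ moved X c ⊆ V := by
  obtain ⟨c, hc, hc', hcV⟩ := hΓ.exists_order 2 V hV hne
  refine ⟨c, ?_, hcV⟩
  norm_num at hc hc'
  rwa [show 12 = 8 + 4 from rfl, pow_add, hc', one_mul]

end LocalInvolutions

/-! ### Algebraic disjointness -/

section AlgebraicDisjointness

/-- Rubin's algebraic disjointness, a group-theoretic substitute for disjointness of supports: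
every `h` not commuting with `f` has a nontrivial double commutator `⁅a, ⁅b, h⁆⁆` with elements of
the centralizer of `g` that again lies in this centralizer. -/
def AlgDisjoint {Γ : Type*} [Group Γ] (f g : Γ) : Prop :=
  ∀ h, ¬ Commute f h → ∃ a b, Commute a g ∧ Commute b g ∧ ⁅a, ⁅b, h⁆⁆ ≠ 1 ∧ Commute ⁅a, ⁅b, h⁆⁆ g

theorem AlgDisjoint.map {Γ Δ : Type*} [Group Γ] [Group Δ] (α : Γ ≃* Δ) {f g : Γ}
    (h : AlgDisjoint f g) : AlgDisjoint (α f) (α g) := by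
  intro k hk
  obtain ⟨k, rfl⟩ := α.surjective k
  obtain ⟨a, b, ha, hb, hne, hc⟩ := h k fun hc => hk (hc.map α)
  refine ⟨α a, α b, ha.map α, hb.map α, ?_, ?_⟩
  · rw [← map_commutatorElement, ← map_commutatorElement]
    exact fun e => hne (α.map_eq_one_iff.1 e)
  · rw [← map_commutatorElement, ← map_commutatorElement]
    exact hc.map α

variable {Γ X : Type*} [Group Γ] [MulAction Γ X] [TopologicalSpace X]
  [T2Space X] [ContinuousConstSMul Γ X] [FaithfulSMul Γ X]

/-- If `h` does not commute with `f`, it displaces a small set `V` inside the support of `f`; two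
noncommuting elements supported in `V` serve as `a` and `b`. -/
theorem HasLocalInvolutions.algDisjoint_of_disjoint (hΓ : HasLocalInvolutions Γ X) {f g : Γ}
    (hd : ∀ x ∈ moved X f, x ∉ moved X g) : AlgDisjoint f g := by
  intro h hfh
  obtain ⟨x, hxf, hxh⟩ : ∃ x ∈ moved X f, x ∈ moved X h := by
    by_contra hn
    push Not at hn
    exact hfh (commute_of_disjoint_moved hn)
  obtain ⟨V, hVf, hV, hxV, hdV⟩ :=
    exists_isOpen_displaced {h} (by simpa using hxh) (isOpen_moved X f) hxf
  obtain ⟨a, b, ha, hb, hab⟩ := hΓ.exists_not_commute hV ⟨x, hxV⟩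
  have hconj : ∀ c : Γ, moved X c ⊆ V → Commute c (h * b⁻¹ * h⁻¹) := by
    intro c hc
    refine (commute_of_disjoint_moved (X := X) fun y hy hy' => ?_)
    rw [← inv_smul_mem_moved_iff, moved_inv] at hy'
    refine hdV h (by simp) _ (hb hy') ?_
    rw [smul_inv_smul]
    exact hc hy
  -- The conjugate of `b⁻¹` by `h` lives outside `V`, so it drops out of the double commutator.
  have key : ⁅a, ⁅b, h⁆⁆ = ⁅a, b⁆ := by
    have h1 : ⁅b, h⁆ = b * (h * b⁻¹ * h⁻¹) := by rw [commutatorElement_def]; group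
    have h2 := (hconj a ha).inv_left.eq
    rw [h1, commutatorElement_def, commutatorElement_def]
    generalize h * b⁻¹ * h⁻¹ = w at *
    calc a * (b * w) * a⁻¹ * (b * w)⁻¹ = a * b * (w * a⁻¹) * w⁻¹ * b⁻¹ := by group
      _ = a * b * a⁻¹ * b⁻¹ := by rw [← h2]; group
  have hag : Commute a g := commute_of_disjoint_moved fun y hy => hd y (hVf (ha hy))
  have hbg : Commute b g := commute_of_disjoint_moved fun y hy => hd y (hVf (hb hy))
  refine ⟨a, b, hag, hbg, ?_, ?_⟩
  · rwa [key, ne_eq, commutatorElement_eq_one_iff_commute]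
  · rw [key, commutatorElement_def]
    exact ((hag.mul_left hbg).mul_left hag.inv_left).mul_left hbg.inv_left

/-- The pigeonhole step: a point moved by both `f` and `g ^ 12` has a neighbourhood `V` with five
disjoint translates under powers of `g`, whereas a double commutator built from an element supported
in `V` has its support in four translates of `V` by elements of the centralizer of `g`. -/
theorem HasLocalInvolutions.disjoint_of_algDisjoint (hΓ : HasLocalInvolutions Γ X) {f g : Γ}
    (hfg : AlgDisjoint f g) : ∀ x ∈ moved X f, x ∉ moved X (g ^ 12) := by
  classical
  intro x hxf hxg
  have hpow : ∀ j ∈ Finset.Icc 1 4, x ∈ moved X (g ^ j) := by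
    intro j hj
    rw [Finset.mem_Icc] at hj
    -- The exponent `12` is the least common multiple of `1, 2, 3, 4`.
    obtain ⟨k, hk⟩ : j ∣ 12 := by
      obtain ⟨h1, h2⟩ := hj
      interval_cases j <;> norm_num
    rw [hk, pow_mul] at hxg
    exact moved_pow_subset _ _ hxg
  obtain ⟨V, -, hV, hxV, hd⟩ := exists_isOpen_displaced
    (insert f ((Finset.Icc 1 4).image (g ^ ·))) (by
      intro k hk
      rw [Finset.mem_insert, Finset.mem_image] at hk
      rcases hk with rfl | ⟨j, hj, rfl⟩
      · exact hxf
      · exact hpow j hj) isOpen_univ (mem_univ x)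
  obtain ⟨h, hh, -, hhV⟩ := hΓ V hV ⟨x, hxV⟩
  obtain ⟨a, b, ha, hb, hne, hc⟩ := hfg h fun hc =>
    not_commute_of_displaces hh hhV (hd f (Finset.mem_insert_self _ _)) hc.symm
  obtain ⟨y, hy⟩ := moved_nonempty X hne
  have hcover : ∀ z ∈ moved X ⁅a, ⁅b, h⁆⁆,
      ∃ i : Fin 4, (![1, b⁻¹, a⁻¹, b⁻¹ * a⁻¹] i : Γ) • z ∈ V := by
    intro z hz
    rcases mem_moved_commutator hz with hz | hz <;> rcases mem_moved_commutator hz with hz | hz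
    · exact ⟨0, by simpa using hhV hz⟩
    · exact ⟨1, by simpa using hhV hz⟩
    · exact ⟨2, by simpa using hhV hz⟩
    · exact ⟨3, by simpa [mul_smul] using hhV hz⟩
  have hcomm : ∀ i : Fin 4, Commute (![1, b⁻¹, a⁻¹, b⁻¹ * a⁻¹] i : Γ) g := by
    intro i
    fin_cases i
    · exact Commute.one_left g
    · exact hb.inv_left
    · exact ha.inv_left
    · exact hb.inv_left.mul_left ha.inv_left
  -- The five points `g ^ j • y` lie in the support of the commutator, and the same centralizing
  -- element takes two of them into `V`.
  choose e he using fun j : Fin 5 =>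
    hcover (g ^ (j : ℕ) • y) (smul_mem_moved_of_commute (hc.pow_right _) hy)
  obtain ⟨i, j, hij, heij⟩ := Fintype.exists_ne_map_eq_of_card_lt e (by simp)
  wlog hlt : i < j generalizing i j
  · exact this j i hij.symm heij.symm (lt_of_le_of_ne (not_lt.1 hlt) hij.symm)
  have hlt' : (i : ℕ) < j := hlt
  have hj := he j
  rw [← heij, show (j : ℕ) = (j - i) + i by omega, pow_add, mul_smul, ← mul_smul,
    ((hcomm (e i)).pow_right _).eq, mul_smul] at hj
  refine hd (g ^ ((j : ℕ) - i)) (Finset.mem_insert_of_mem (Finset.mem_image_of_mem _ ?_)) _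
    (he i) hj
  rw [Finset.mem_Icc]
  omega

/-- Inclusion of supports, up to closure, is a group-theoretic relation. -/
theorem HasLocalInvolutions.moved_subset_closure_iff (hΓ : HasLocalInvolutions Γ X) {f h : Γ} :
    moved X h ⊆ closure (moved X f) ↔ ∀ g, AlgDisjoint f g → Commute h (g ^ 12) := by
  constructor
  · intro hsub g hg
    refine commute_of_disjoint_moved (X := X) fun x hx hxg => ?_
    obtain ⟨y, hyg, hyf⟩ := mem_closure_iff.1 (hsub hx) _ (isOpen_moved X (g ^ 12)) hxg
    exact hΓ.disjoint_of_algDisjoint hg y hyf hyg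
  · intro H x hx
    by_contra hxf
    obtain ⟨V, hVf, hV, hxV, hd⟩ := exists_isOpen_displaced {h} (by simpa using hx)
      isClosed_closure.isOpen_compl hxf
    obtain ⟨c, hc, hcV⟩ := hΓ.exists_pow_twelve_ne_one hV ⟨x, hxV⟩
    have hfc : AlgDisjoint f c := hΓ.algDisjoint_of_disjoint fun y hy hyc =>
      hVf (hcV hyc) (subset_closure hy)
    exact not_commute_of_displaces hc ((moved_pow_subset c 12).trans hcV) (hd h (by simp))
      (H c hfc).symm

variable {Δ Y : Type*} [Group Δ] [MulAction Δ Y] [TopologicalSpace Y]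
  [T2Space Y] [ContinuousConstSMul Δ Y] [FaithfulSMul Δ Y]

theorem HasLocalInvolutions.moved_map_subset_closure (hΓ : HasLocalInvolutions Γ X)
    (hΔ : HasLocalInvolutions Δ Y) (α : Γ ≃* Δ) {f h : Γ}
    (hfh : moved X h ⊆ closure (moved X f)) : moved Y (α h) ⊆ closure (moved Y (α f)) := by
  rw [hΓ.moved_subset_closure_iff] at hfh
  rw [hΔ.moved_subset_closure_iff]
  intro g hg
  have := (hfh (α.symm g) (by simpa using hg.map α.symm)).map α
  simpa using this

/-- Isomorphisms preserve disjointness of supports. -/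
theorem HasLocalInvolutions.disjoint_moved_map (hΓ : HasLocalInvolutions Γ X)
    (hΔ : HasLocalInvolutions Δ Y) (α : Γ ≃* Δ) {f g : Γ}
    (hd : ∀ x ∈ moved X f, x ∉ moved X g) : ∀ y ∈ moved Y (α f), y ∉ moved Y (α g) := by
  intro y hyf hyg
  obtain ⟨k, hk, -, hkV⟩ := hΔ (moved Y (α f) ∩ moved Y (α g))
    ((isOpen_moved Y _).inter (isOpen_moved Y _)) ⟨y, hyf, hyg⟩
  have key : ∀ e : Γ, moved Y k ⊆ moved Y (α e) → moved X (α.symm k) ⊆ closure (moved X e) := by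
    intro e he
    simpa using hΔ.moved_map_subset_closure hΓ α.symm (he.trans subset_closure)
  have hk' : α.symm k ≠ 1 := by simpa using hk
  obtain ⟨x, hx⟩ := moved_nonempty X hk'
  obtain ⟨x', hx', hx'f⟩ := mem_closure_iff.1 (key f (hkV.trans inter_subset_left) hx) _
    (isOpen_moved X _) hx
  obtain ⟨x'', ⟨-, hx''f⟩, hx''g⟩ := mem_closure_iff.1
    (key g (hkV.trans inter_subset_right) hx') _
    ((isOpen_moved X (α.symm k)).inter (isOpen_moved X f)) ⟨hx', hx'f⟩
  exact hd x'' hx''f hx''g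

end AlgebraicDisjointness

/-! ### Full actions and their involutions -/

section FullAction

variable {Γ X : Type*} [Group Γ] [MulAction Γ X] [TopologicalSpace X]

variable (Γ X) in
/-- `Γ` contains every homeomorphism that maps each point into its own `Γ`-orbit. -/
def IsFullAction : Prop :=
  ∀ φ : X ≃ₜ X, (∀ x, ∃ g : Γ, g • x = φ x) → ∃ g : Γ, ∀ x, g • x = φ x

variable (Γ X) in
/-- A full action with small involutions, all of whose orbits have at least three points. -/
structure IsAbundantAction : Prop where
  localInvolutions : HasLocalInvolutions Γ X
  full : IsFullAction Γ X
  three_le_orbit : ∀ x : X, ∃ g h : Γ, g • x ≠ x ∧ h • x ≠ x ∧ g • x ≠ h • x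

theorem IsFullAction.exists_eq_of_involutive (hΓ : IsFullAction Γ X) {f : X → X}
    (hf : Function.Involutive f) (hc : Continuous f) (h : ∀ x, ∃ g : Γ, g • x = f x) :
    ∃ g : Γ, ∀ x, g • x = f x :=
  hΓ { toEquiv := hf.toPerm, continuous_toFun := hc, continuous_invFun := hc } h

variable [ContinuousConstSMul Γ X]

/-- An involution may be cut off outside a clopen set that it preserves. -/
theorem IsFullAction.exists_restrict (hΓ : IsFullAction Γ X) {t : Γ} (ht : t * t = 1) {D : Set X}
    (hD : IsClopen D) (htD : ∀ x ∈ D, t • x ∈ D) :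
    ∃ s : Γ, (∀ x ∈ D, s • x = t • x) ∧ ∀ x ∉ D, s • x = x := by
  classical
  obtain ⟨s, hs⟩ := hΓ.exists_eq_of_involutive (f := D.piecewise (t • ·) id) (by
      intro x
      by_cases hx : x ∈ D
      · rw [piecewise_eq_of_mem _ _ _ hx, piecewise_eq_of_mem _ _ _ (htD x hx),
          ← mul_smul, ht, one_smul]
      · simp [hx])
    ((continuous_const_smul t).piecewise (by simp [hD.frontier_eq]) continuous_id) (by
      intro x
      by_cases hx : x ∈ D
      · exact ⟨t, by simp [hx]⟩
      · exact ⟨1, by simp [hx]⟩)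
  exact ⟨s, fun x hx => by simp [hs, hx], fun x hx => by simp [hs, hx]⟩

variable [T2Space X] [FaithfulSMul Γ X] [CompactSpace X] [TotallyDisconnectedSpace X]

/-- Near a point moved by `g`, the element `g` agrees with an involution: the one that exchanges a
small clopen neighbourhood with its image. -/
theorem IsFullAction.exists_involution_eq (hΓ : IsFullAction Γ X) {g : Γ} {x : X}
    (hx : g • x ≠ x) :
    ∃ t : Γ, t * t = 1 ∧ ∃ V, IsOpen V ∧ x ∈ V ∧ ∀ y ∈ V, t • y = g • y := by
  classical
  obtain ⟨U, -, hU, hxU, hdU⟩ :=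
    exists_isOpen_displaced {g} (by simpa [mem_moved] using hx) isOpen_univ (mem_univ x)
  obtain ⟨V, hV, hxV, hVU⟩ := compact_exists_isClopen_in_isOpen hU hxU
  have hd : ∀ y ∈ V, g • y ∉ V := fun y hy h => hdU g (by simp) y (hVU hy) (hVU h)
  have hW : IsClopen ((g⁻¹ • · : X → X) ⁻¹' V) := hV.preimage (continuous_const_smul g⁻¹)
  set W : Set X := (g⁻¹ • · : X → X) ⁻¹' V with hWdef
  have hgW : ∀ y ∈ V, g • y ∈ W := fun y hy => by simpa [hWdef] using hy
  have hWV : ∀ y ∈ W, y ∉ V := fun y hy h => hd _ hy (by simpa using h)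
  obtain ⟨f, hf⟩ : ∃ f : X → X, f = V.piecewise (g • ·) (W.piecewise (g⁻¹ • ·) id) := ⟨_, rfl⟩
  have f1 : ∀ y ∈ V, f y = g • y := fun y hy => by simp [hf, hy]
  have f2 : ∀ y ∈ W, f y = g⁻¹ • y := fun y hy => by simp [hf, hy, hWV y hy]
  have f3 : ∀ y, y ∉ V → y ∉ W → f y = y := fun y hy hy' => by simp [hf, hy, hy']
  have hinv : Function.Involutive f := by
    intro y
    by_cases hy : y ∈ V
    · rw [f1 y hy, f2 _ (hgW y hy), inv_smul_smul]
    · by_cases hy' : y ∈ W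
      · rw [f2 y hy', f1 _ hy', smul_inv_smul]
      · rw [f3 y hy hy', f3 y hy hy']
  have hcont : Continuous f := by
    rw [hf]
    exact (continuous_const_smul g).piecewise (by simp [hV.frontier_eq])
      ((continuous_const_smul g⁻¹).piecewise (by simp [hW.frontier_eq]) continuous_id)
  obtain ⟨t, ht⟩ := hΓ.exists_eq_of_involutive hinv hcont (by
    intro y
    by_cases hy : y ∈ V
    · exact ⟨g, (f1 y hy).symm⟩
    · by_cases hy' : y ∈ W
      · exact ⟨g⁻¹, (f2 y hy').symm⟩
      · exact ⟨1, by rw [f3 y hy hy', one_smul]⟩)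
  have htt : t * t = 1 := FaithfulSMul.eq_of_smul_eq_smul (α := X) fun y => by
    rw [mul_smul, ht, ht, hinv y, one_smul]
  exact ⟨t, htt, V, hV.isOpen, hxV, fun y hy => by rw [ht, f1 y hy]⟩

end FullAction

/-! ### Traces of clopen sets -/

section Trace

variable {Γ X Δ Y : Type*} [Group Γ] [MulAction Γ X] [Group Δ] [MulAction Δ Y]

variable (X) in
/-- The trace in `X` of a set `D` in `Y`: the union of the supports of the elements of `Γ` whose
images under `α` are supported in `D`. -/
def trace (α : Γ ≃* Δ) (D : Set Y) : Set X :=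
  {x | ∃ g : Γ, x ∈ moved X g ∧ moved Y (α g) ⊆ D}

variable [TopologicalSpace X] [T2Space X] [ContinuousConstSMul Γ X]

variable (X) in
theorem isOpen_trace (α : Γ ≃* Δ) (D : Set Y) : IsOpen (trace X α D) := by
  have : trace X α D = ⋃ g ∈ {g : Γ | moved Y (α g) ⊆ D}, moved X g := by
    ext x
    simp [trace, and_comm]
  rw [this]
  exact isOpen_biUnion fun g _ => isOpen_moved X g

variable [FaithfulSMul Γ X] [TopologicalSpace Y] [T2Space Y]
  [ContinuousConstSMul Δ Y] [FaithfulSMul Δ Y]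

/-- Together, the traces of a clopen set and of its complement are dense. -/
theorem dense_trace_union (hΓ : HasLocalInvolutions Γ X) (hΔ : HasLocalInvolutions Δ Y)
    (α : Γ ≃* Δ) {D : Set Y} (hD : IsClopen D) : Dense (trace X α D ∪ trace X α Dᶜ) := by
  rw [dense_iff_inter_open]
  intro V hV hne
  obtain ⟨k, hk, -, hkV⟩ := hΓ V hV hne
  obtain ⟨y, hy⟩ := moved_nonempty Y (g := α k) (by simpa using hk)
  have key : ∀ E : Set Y, IsOpen E → y ∈ E → (V ∩ trace X α E).Nonempty := by
    intro E hE hyE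
    obtain ⟨l, hl, -, hlE⟩ := hΔ (moved Y (α k) ∩ E) ((isOpen_moved Y _).inter hE) ⟨y, hy, hyE⟩
    have hsub : moved X (α.symm l) ⊆ closure (moved X k) := by
      simpa using hΔ.moved_map_subset_closure hΓ α.symm
        ((hlE.trans inter_subset_left).trans (subset_closure (s := moved Y (α k))))
    obtain ⟨p, hp⟩ := moved_nonempty X (g := α.symm l) (by simpa using hl)
    obtain ⟨q, hq, hqk⟩ := mem_closure_iff.1 (hsub hp) _ (isOpen_moved X _) hp
    exact ⟨q, hkV hqk, α.symm l, hq, by simpa using hlE.trans inter_subset_right⟩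
  by_cases hyD : y ∈ D
  · exact (key D hD.isOpen hyD).mono (inter_subset_inter_right _ subset_union_left)
  · exact (key Dᶜ hD.compl.isOpen hyD).mono (inter_subset_inter_right _ subset_union_right)

/-- The effect of fullness on traces. Let `x` lie in the closure of the trace of `D` and let an
involution `τ` move `x`. The image of `τ` can be cut off outside the clopen set
`E = D ∪ α τ • D`; the resulting element of `Γ` agrees with `τ` on the trace of `D`, hence at `x`,
but fixes the trace of the complement of `E`, which therefore stays away from `x`. -/
theorem exists_isOpen_trace_compl_displaced (hΓ : HasLocalInvolutions Γ X)
    (hΔ : HasLocalInvolutions Δ Y) (hfull : IsFullAction Δ Y) (α : Γ ≃* Δ) {D : Set Y}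
    (hD : IsClopen D) {τ : Γ} (hτ : τ * τ = 1) {x : X} (hx : x ∈ closure (trace X α D))
    (hτx : τ • x ≠ x) :
    ∃ V, IsOpen V ∧ x ∈ V ∧ ∀ p ∈ V, p ∈ trace X α Dᶜ → τ • p ∉ trace X α Dᶜ := by
  have htt : α τ * α τ = 1 := by rw [← map_mul, hτ, map_one]
  have htt' : ∀ y : Y, α τ • α τ • y = y := fun y => by rw [← mul_smul, htt, one_smul]
  obtain ⟨s, hsE, hsE'⟩ := hfull.exists_restrict htt (D := D ∪ (α τ • ·) ⁻¹' D)
    (hD.union (hD.preimage (continuous_const_smul _))) (by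
      rintro y (hy | hy)
      · exact Or.inr (by simpa [htt'] using hy)
      · exact Or.inl hy)
  obtain ⟨σ, rfl⟩ := α.surjective s
  have h1 : ∀ p ∈ trace X α D, σ • p = τ • p := by
    rintro p ⟨e, hpe, heD⟩
    have hdis : ∀ y ∈ moved Y (α e), y ∉ moved Y (α (τ⁻¹ * σ)) := by
      intro y hy
      rw [notMem_moved, map_mul, map_inv, mul_smul, hsE y (Or.inl (heD hy)), inv_smul_smul]
    have := hΔ.disjoint_moved_map hΓ α.symm hdis p (by simpa using hpe)
    rw [α.symm_apply_apply, notMem_moved, mul_smul, inv_smul_eq_iff] at this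
    exact this
  have h2 : σ • x = τ • x :=
    closure_minimal (t := {p | σ • p = τ • p}) h1
      (isClosed_eq (continuous_const_smul σ) (continuous_const_smul τ)) hx
  refine ⟨moved X σ, isOpen_moved X σ, by rwa [mem_moved, h2], ?_⟩
  rintro p hpσ ⟨e, hpe, heD⟩ ⟨e', hpe', heD'⟩
  have hpe'' : p ∈ moved X (τ⁻¹ * e' * τ) := by
    have := inv_smul_mem_moved_iff (X := X) (g := e') (h := τ⁻¹) (x := p)
    rw [inv_inv] at this
    exact this.1 hpe'
  have heD'' : moved Y (α (τ⁻¹ * e' * τ)) ⊆ (α τ • · : Y → Y) ⁻¹' Dᶜ := by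
    intro y hy
    have := inv_smul_mem_moved_iff (X := Y) (g := α e') (h := (α τ)⁻¹) (x := y)
    rw [inv_inv] at this
    exact heD' (this.2 (by simpa using hy))
  obtain ⟨k, hk, -, hkV⟩ := hΓ (moved X e ∩ moved X (τ⁻¹ * e' * τ) ∩ moved X σ)
    (((isOpen_moved X _).inter (isOpen_moved X _)).inter (isOpen_moved X _)) ⟨p, ⟨hpe, hpe''⟩, hpσ⟩
  have hsub : ∀ c : Γ, ∀ F : Set Y, moved X k ⊆ moved X c → moved Y (α c) ⊆ F → IsClosed F →
      moved Y (α k) ⊆ F := fun c F hc hF hcl =>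
    (hΓ.moved_map_subset_closure hΔ α (hc.trans subset_closure)).trans (closure_minimal hF hcl)
  have hkD := hsub e _ (fun q hq => (hkV hq).1.1) heD hD.compl.isClosed
  have hkD' := hsub _ _ (fun q hq => (hkV hq).1.2) heD''
    (hD.compl.isClosed.preimage (continuous_const_smul _))
  have hdis : ∀ y ∈ moved Y (α k), y ∉ moved Y (α σ) := by
    intro y hy
    rw [notMem_moved]
    refine hsE' y ?_
    rintro (h | h)
    · exact hkD hy h
    · exact hkD' hy h
  obtain ⟨q, hq⟩ := moved_nonempty X hk
  have := hΔ.disjoint_moved_map hΓ α.symm hdis q (by simpa using hq)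
  rw [α.symm_apply_apply] at this
  exact this (hkV hq).2

variable [CompactSpace X] [TotallyDisconnectedSpace X]

/-- Traces of complementary clopen sets have disjoint closures. At a common point `x` of the
closures of the traces `A` and `B`, an involution moving `x` would have to interchange `A` and `B`
near `x`. The same would hold at each point of the orbit of `x`. This is impossible for three points:
with only two sets available, two of the points would carry the same set. -/
theorem disjoint_closure_trace (hΓ : IsAbundantAction Γ X) (hΔ : IsAbundantAction Δ Y)
    (α : Γ ≃* Δ) {D : Set Y} (hD : IsClopen D) :
    Disjoint (closure (trace X α D)) (closure (trace X α Dᶜ)) := by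
  rw [Set.disjoint_left]
  intro x hxA hxB
  have hdense := dense_trace_union hΓ.localInvolutions hΔ.localInvolutions α hD
  have hopen : IsOpen (trace X α D ∪ trace X α Dᶜ) := (isOpen_trace X α D).union (isOpen_trace X α _)
  have hN := fun (τ : Γ) (hτ : τ * τ = 1) (z : X) (hz : z ∈ closure (trace X α D))
    (h : τ • z ≠ z) => exists_isOpen_trace_compl_displaced hΓ.localInvolutions
      hΔ.localInvolutions hΔ.full α hD hτ hz h
  have hN' := fun (τ : Γ) (hτ : τ * τ = 1) (h : τ • x ≠ x) =>
    exists_isOpen_trace_compl_displaced hΓ.localInvolutions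
      hΔ.localInvolutions hΔ.full α hD.compl hτ hxB h
  rw [compl_compl] at hN'
  obtain ⟨g, h, hg, hh, hgh⟩ := hΓ.three_le_orbit x
  obtain ⟨τ₁, hτ₁, V₁, hV₁, hxV₁, hV₁g⟩ := hΓ.full.exists_involution_eq hg
  obtain ⟨τ₂, hτ₂, V₂, hV₂, hxV₂, hV₂h⟩ := hΓ.full.exists_involution_eq hh
  obtain ⟨τ₃, hτ₃, V₃, hV₃, hxV₃, hV₃h⟩ :=
    hΓ.full.exists_involution_eq (g := h * g⁻¹) (x := g • x)
      (by rw [mul_smul, inv_smul_smul]; exact hgh.symm)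
  have hτ₁x : τ₁ • x = g • x := hV₁g x hxV₁
  obtain ⟨U, hU, hxU, hUB⟩ := hN τ₁ hτ₁ x hxA (by rwa [hτ₁x])
  obtain ⟨U₁, hU₁, hxU₁, hUA₁⟩ := hN' τ₁ hτ₁ (by rwa [hτ₁x])
  obtain ⟨U₂, hU₂, hxU₂, hUA₂⟩ := hN' τ₂ hτ₂ (by rwa [hV₂h x hxV₂])
  have hpre : ∀ τ : Γ, Dense ((τ • · : X → X) ⁻¹' (trace X α D ∪ trace X α Dᶜ)) := fun τ =>
    hdense.preimage (isOpenMap_smul τ)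
  -- As `τ₁` maps no point of `B` near `x` into `B`, the set `A` accumulates at `g • x`, too.
  have hgx : g • x ∈ closure (trace X α D) := by
    rw [mem_closure_iff]
    intro O hO hgO
    have hO' : IsOpen ((τ₁ • · : X → X) ⁻¹' O ∩ U) :=
      (hO.preimage (continuous_const_smul _)).inter hU
    obtain ⟨q, hq, hqB⟩ := mem_closure_iff.1 hxB _ hO' ⟨by simpa [hτ₁x] using hgO, hxU⟩
    obtain ⟨p, ⟨⟨hpO, hpU⟩, hpB⟩, hp⟩ :=
      (hpre τ₁).inter_open_nonempty _ (hO'.inter (isOpen_trace X α Dᶜ)) ⟨q, hq, hqB⟩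
    exact ⟨τ₁ • p, hpO, hp.resolve_right (hUB p hpU hpB)⟩
  obtain ⟨W, hW, hxW, hWB⟩ := hN τ₃ hτ₃ (g • x) hgx (by
    rw [hV₃h _ hxV₃, mul_smul, inv_smul_smul]; exact hgh.symm)
  -- A point `p` of `A` near `x` is mapped into `B` by both `τ₁` and `τ₂`, while `τ₃` maps the former
  -- image to the latter.
  have hO : IsOpen (V₁ ∩ V₂ ∩ (U₁ ∩ U₂) ∩ (τ₁ • · : X → X) ⁻¹' (V₃ ∩ W)) :=
    ((hV₁.inter hV₂).inter (hU₁.inter hU₂)).inter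
      ((hV₃.inter hW).preimage (continuous_const_smul _))
  obtain ⟨q, hq, hqA⟩ := mem_closure_iff.1 hxA _ hO
    ⟨⟨⟨hxV₁, hxV₂⟩, hxU₁, hxU₂⟩, by simpa [hτ₁x] using ⟨hxV₃, hxW⟩⟩
  obtain ⟨p, ⟨⟨⟨⟨hpV₁, hpV₂⟩, hpU₁, hpU₂⟩, hpV₃, hpW⟩, hpA⟩, hp₁, hp₂⟩ :=
    ((hpre τ₁).inter_of_isOpen_left (hpre τ₂)
      (hopen.preimage (continuous_const_smul _))).inter_open_nonempty _
      (hO.inter (isOpen_trace X α D)) ⟨q, hq, hqA⟩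
  have h₁ := hp₁.resolve_left (hUA₁ p hpU₁ hpA)
  have h₂ := hp₂.resolve_left (hUA₂ p hpU₂ hpA)
  refine hWB _ hpW h₁ ?_
  have : τ₃ • τ₁ • p = τ₂ • p := by
    rw [hV₃h (τ₁ • p) hpV₃, hV₁g p hpV₁, hV₂h p hpV₂, mul_smul, inv_smul_smul]
  simpa only [this] using h₂

end Trace

/-! ### The point correspondence -/

section Correspondence

variable {Γ X Δ Y : Type*} [Group Γ] [MulAction Γ X] [Group Δ] [MulAction Δ Y]
  [TopologicalSpace X] [TopologicalSpace Y]

/-- The points `x` and `y` correspond under `α` if some nontrivial element with support as close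
to `x` as desired has an image under `α` with support as close to `y` as desired. -/
def Corresponds (α : Γ ≃* Δ) (x : X) (y : Y) : Prop :=
  ∀ U V, IsOpen U → IsOpen V → x ∈ U → y ∈ V →
    ∃ g : Γ, g ≠ 1 ∧ moved X g ⊆ U ∧ moved Y (α g) ⊆ V

theorem Corresponds.symm {α : Γ ≃* Δ} {x : X} {y : Y} (h : Corresponds α x y) :
    Corresponds α.symm y x := by
  intro V U hV hU hy hx
  obtain ⟨g, hg, hgU, hgV⟩ := h U V hU hV hx hy
  exact ⟨α g, by simpa using hg, hgV, by simpa using hgU⟩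

theorem Corresponds.smul [ContinuousConstSMul Γ X] [ContinuousConstSMul Δ Y]
    {α : Γ ≃* Δ} {x : X} {y : Y} (h : Corresponds α x y) (g : Γ) :
    Corresponds α (g • x) (α g • y) := by
  intro U V hU hV hx hy
  obtain ⟨k, hk, hkU, hkV⟩ := h _ _ (hU.preimage (continuous_const_smul g))
    (hV.preimage (continuous_const_smul (α g))) hx hy
  refine ⟨g * k * g⁻¹, by simpa using hk, fun p hp => ?_, fun p hp => ?_⟩
  · rw [← inv_smul_mem_moved_iff] at hp
    simpa using hkU hp
  · rw [map_mul, map_mul, map_inv, ← inv_smul_mem_moved_iff] at hp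
    simpa using hkV hp

theorem Corresponds.mem_closure_trace [FaithfulSMul Γ X] {α : Γ ≃* Δ} {x : X} {y : Y}
    (h : Corresponds α x y) {D : Set Y} (hD : IsOpen D) (hy : y ∈ D) : x ∈ closure (trace X α D) := by
  rw [mem_closure_iff]
  intro U hU hx
  obtain ⟨g, hg, hgU, hgD⟩ := h U D hU hD hx hy
  obtain ⟨p, hp⟩ := moved_nonempty X hg
  exact ⟨p, hgU hp, g, hp, hgD⟩

variable [T2Space X] [ContinuousConstSMul Γ X] [FaithfulSMul Γ X]
  [T2Space Y] [ContinuousConstSMul Δ Y] [FaithfulSMul Δ Y]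
  [CompactSpace X] [TotallyDisconnectedSpace X] [CompactSpace Y]

theorem exists_corresponds (hΓ : HasLocalInvolutions Γ X) (hΔ : HasLocalInvolutions Δ Y)
    (α : Γ ≃* Δ) (x : X) : ∃ y : Y, Corresponds α x y := by
  by_contra hn
  -- Otherwise finitely many of the offending `V y` cover `Y`; an element supported in the
  -- intersection of the associated `U y` has an image moving points of one of these `V y`.
  simp only [Corresponds, not_exists, not_forall] at hn
  choose U V hU hV hx hy hno using hn
  obtain ⟨t, ht⟩ := CompactSpace.elim_nhds_subcover V fun y => (hV y).mem_nhds (hy y)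
  obtain ⟨C, hC, hxC, hCU⟩ := compact_exists_isClopen_in_isOpen
    (isOpen_biInter_finset (s := t) fun y _ => hU y) (mem_iInter₂.2 fun y _ => hx y)
  obtain ⟨k, hk, -, hkC⟩ := hΓ C hC.isOpen ⟨x, hxC⟩
  obtain ⟨z, hz⟩ := moved_nonempty Y (g := α k) (by simpa using hk)
  obtain ⟨y, hyt, hzy⟩ := mem_iUnion₂.1 (ht.symm ▸ mem_univ z : z ∈ ⋃ y ∈ t, V y)
  obtain ⟨l, hl, -, hlV⟩ := hΔ (moved Y (α k) ∩ V y) ((isOpen_moved Y _).inter (hV y)) ⟨z, hz, hzy⟩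
  have hsub : moved X (α.symm l) ⊆ closure (moved X k) := by
    simpa using hΔ.moved_map_subset_closure hΓ α.symm
      ((hlV.trans inter_subset_left).trans (subset_closure (s := moved Y (α k))))
  refine hno y (α.symm l) ⟨by simpa using hl, fun p hp => ?_, ?_⟩
  · exact mem_iInter₂.1 (hCU (closure_minimal hkC hC.isClosed (hsub hp))) y hyt
  · simpa using hlV.trans inter_subset_right

variable [TotallyDisconnectedSpace Y]

theorem Corresponds.unique (hΓ : IsAbundantAction Γ X) (hΔ : IsAbundantAction Δ Y)
    {α : Γ ≃* Δ} {x : X} {y y' : Y} (h : Corresponds α x y) (h' : Corresponds α x y') : y = y' := by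
  by_contra hne
  obtain ⟨D, hD, hy, hDy'⟩ := compact_exists_isClopen_in_isOpen
    (isOpen_compl_singleton (x := y')) hne
  exact Set.disjoint_left.1 (disjoint_closure_trace hΓ hΔ α hD) (h.mem_closure_trace hD.isOpen hy)
    (h'.mem_closure_trace hD.compl.isOpen fun hy' => hDy' hy' rfl)

/-- Every isomorphism between two abundant actions on Stone spaces is spatial. -/
theorem exists_homeomorph_of_mulEquiv (hΓ : IsAbundantAction Γ X) (hΔ : IsAbundantAction Δ Y)
    (α : Γ ≃* Δ) : ∃ Λ : X ≃ₜ Y, ∀ (g : Γ) (x : X), Λ (g • x) = α g • Λ x := by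
  choose F hF using exists_corresponds hΓ.localInvolutions hΔ.localInvolutions α
  choose K hK using exists_corresponds hΔ.localInvolutions hΓ.localInvolutions α.symm
  have hcont : Continuous F := by
    rw [(isTopologicalBasis_isClopen (X := Y)).continuous_iff]
    intro D hD
    have : F ⁻¹' D = (closure (trace X α Dᶜ))ᶜ := by
      ext x
      by_cases hx : F x ∈ D
      · exact iff_of_true hx (Set.disjoint_left.1 (disjoint_closure_trace hΓ hΔ α hD)
          ((hF x).mem_closure_trace hD.isOpen hx))
      · exact iff_of_false hx fun h => h ((hF x).mem_closure_trace hD.compl.isOpen hx)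
    rw [this]
    exact isClosed_closure.isOpen_compl
  let e : X ≃ Y :=
    { toFun := F
      invFun := K
      left_inv := fun x => (hK (F x)).unique hΔ hΓ (hF x).symm
      right_inv := fun y => (hF (K y)).unique hΓ hΔ (hK y).symm }
  exact ⟨hcont.homeoOfEquivCompactToT2 (f := e), fun g x =>
    (hF (g • x)).unique hΓ hΔ ((hF x).smul g)⟩

end Correspondence

/-! ### Full groups of Cantor systems -/

section FullGroup

variable {X Y : Type*} [TopologicalSpace X] [TopologicalSpace Y]

/-- Homeomorphisms act on the space by evaluation. -/
instance homeomorphMulAction : MulAction (X ≃ₜ X) X where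
  smul g x := g x
  one_smul _ := rfl
  mul_smul _ _ _ := rfl

instance homeomorphFaithfulSMul : FaithfulSMul (X ≃ₜ X) X := ⟨fun h => Homeomorph.ext h⟩

instance homeomorphContinuousConstSMul (Γ : Subgroup (X ≃ₜ X)) : ContinuousConstSMul Γ X :=
  ⟨fun g => g.1.continuous⟩

theorem le_fullGroup (G : Subgroup (X ≃ₜ X)) : G ≤ fullGroup G := fun g hg _ => ⟨g, hg, rfl⟩

theorem isFullAction_fullGroup (G : Subgroup (X ≃ₜ X)) : IsFullAction (fullGroup G) X := by
  intro φ hφ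
  refine ⟨⟨φ, fun x => ?_⟩, fun _ => rfl⟩
  obtain ⟨g, hg⟩ := hφ x
  rw [← hg]
  exact g.2 x

/-- A clopen set is regular open, and a homeomorphism moves no point outside the interior of the
closure of the set of points it moves. -/
theorem HasManyInvolutions.hasLocalInvolutions [T2Space X] [CompactSpace X]
    [TotallyDisconnectedSpace X] {Γ : Subgroup (X ≃ₜ X)} (h : HasManyInvolutions Γ) :
    HasLocalInvolutions Γ X := by
  rintro V hV ⟨x, hx⟩
  obtain ⟨C, hC, hxC, hCV⟩ := compact_exists_isClopen_in_isOpen hV hx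
  have hreg : IsRegularOpen C := by
    rw [IsRegularOpen, hC.isClosed.closure_eq, hC.isOpen.interior_eq]
  obtain ⟨π, hπ, ho, hs⟩ := h C hreg ⟨x, hxC⟩
  refine ⟨⟨π, hπ⟩, fun h1 => ?_, Subtype.ext ?_, fun y hy => hCV (hs ?_)⟩
  · rw [Subgroup.mk_eq_one] at h1
    rw [h1, orderOf_one] at ho
    exact absurd ho (by norm_num)
  · change π * π = 1
    rw [← sq, ← ho, pow_orderOf_eq_one]
  · exact interior_maximal subset_closure (isOpen_moved X (⟨π, hπ⟩ : Γ)) hy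

theorem isAbundantAction_fullGroup [T2Space X] [CompactSpace X] [TotallyDisconnectedSpace X]
    {G : Subgroup (X ≃ₜ X)} (horb : ∀ x, 3 ≤ (orbit G x).encard)
    (hinv : HasManyInvolutions (fullGroup G)) : IsAbundantAction (fullGroup G) X where
  localInvolutions := hinv.hasLocalInvolutions
  full := isFullAction_fullGroup G
  three_le_orbit x := by
    -- Removing `x` leaves at least two points of the orbit.
    have h2 : 1 < (orbit G x \ {x}).encard := by
      have hx : x ∈ orbit G x := ⟨1, G.one_mem, rfl⟩
      by_contra hn
      have h3 := horb x
      rw [← encard_sdiff_singleton_add_one hx] at h3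
      exact absurd (h3.trans (add_le_add_left (not_lt.1 hn) 1)) (by norm_num)
    obtain ⟨a, b, ⟨⟨g, hg, rfl⟩, hgx⟩, ⟨⟨h, hh, rfl⟩, hhx⟩, hab⟩ := one_lt_encard_iff.1 h2
    exact ⟨⟨g, le_fullGroup G hg⟩, ⟨h, le_fullGroup G hh⟩, hgx, hhx, hab⟩

variable {G : Subgroup (X ≃ₜ X)} {H : Subgroup (Y ≃ₜ Y)}

theorem conj_mem_fullGroup {Λ : X ≃ₜ Y} (hΛ : ∀ x, Λ '' orbit G x = orbit H (Λ x)) {g : X ≃ₜ X}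
    (hg : g ∈ fullGroup G) : (Λ.symm.trans g).trans Λ ∈ fullGroup H := by
  intro y
  have : Λ (g (Λ.symm y)) ∈ Λ '' orbit G (Λ.symm y) := mem_image_of_mem _ (hg _)
  rwa [hΛ, Λ.apply_symm_apply] at this

theorem OrbitEquivalent.nonempty_mulEquiv (h : OrbitEquivalent G H) :
    Nonempty (fullGroup G ≃* fullGroup H) := by
  obtain ⟨Λ, hΛ⟩ := h
  have hΛ' : ∀ y, Λ.symm '' orbit H y = orbit G (Λ.symm y) := by
    intro y
    rw [← Λ.apply_symm_apply y, ← hΛ, Λ.symm_apply_apply, ← image_comp, Λ.symm_comp_self, image_id]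
  exact ⟨{
    toFun := fun g => ⟨(Λ.symm.trans g).trans Λ, conj_mem_fullGroup hΛ g.2⟩
    invFun := fun g => ⟨(Λ.symm.symm.trans g).trans Λ.symm, conj_mem_fullGroup hΛ' g.2⟩
    left_inv := fun g => Subtype.ext (Homeomorph.ext fun x => by simp)
    right_inv := fun g => Subtype.ext (Homeomorph.ext fun x => by simp)
    map_mul' := fun g h => Subtype.ext (Homeomorph.ext fun x => by
      change Λ (g.1 (h.1 (Λ.symm x))) = Λ (g.1 (Λ.symm (Λ (h.1 (Λ.symm x)))))
      rw [Λ.symm_apply_apply]) }⟩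

theorem orbitEquivalent_of_conj (α : fullGroup G ≃* fullGroup H) (Λ : X ≃ₜ Y)
    (h : ∀ g : fullGroup G, (α g : Y ≃ₜ Y) = (Λ.symm.trans (g : X ≃ₜ X)).trans Λ) :
    OrbitEquivalent G H := by
  have happ : ∀ (g : fullGroup G) x, (α g : Y ≃ₜ Y) (Λ x) = Λ ((g : X ≃ₜ X) x) := by
    intro g x
    simp [h g]
  refine ⟨Λ, fun x => Subset.antisymm ?_ ?_⟩
  · rintro _ ⟨_, ⟨g, hg, rfl⟩, rfl⟩
    rw [← happ ⟨g, le_fullGroup G hg⟩]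
    exact (α ⟨g, le_fullGroup G hg⟩).2 (Λ x)
  · rintro _ ⟨k, hk, rfl⟩
    obtain ⟨g, hg⟩ := α.surjective ⟨k, le_fullGroup H hk⟩
    refine ⟨(g : X ≃ₜ X) x, g.2 x, ?_⟩
    rw [← happ, hg]

end FullGroup

end CantorSystem

theorem IsCantorSet.compact_t2_totallyDisconnected {X : Type*} [TopologicalSpace X]
    (hX : IsCantorSet X) : CompactSpace X ∧ T2Space X ∧ TotallyDisconnectedSpace X := by
  obtain ⟨e⟩ := hX
  exact ⟨e.symm.compactSpace, e.symm.t2Space, e.symm.totallyDisconnectedSpace⟩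

theorem mainTheorem1 {X₁ X₂ : Type*} [TopologicalSpace X₁] [TopologicalSpace X₂]
    (hX₁ : IsCantorSet X₁) (hX₂ : IsCantorSet X₂)
    (G₁ : Subgroup (X₁ ≃ₜ X₁)) (G₂ : Subgroup (X₂ ≃ₜ X₂))
    (horb₁ : ∀ x, 3 ≤ (CantorSystem.orbit G₁ x).encard)
    (horb₂ : ∀ x, 3 ≤ (CantorSystem.orbit G₂ x).encard)
    (hinv₁ : CantorSystem.HasManyInvolutions (CantorSystem.fullGroup G₁))
    (hinv₂ : CantorSystem.HasManyInvolutions (CantorSystem.fullGroup G₂)) :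
    (CantorSystem.OrbitEquivalent G₁ G₂ ↔
      Nonempty (CantorSystem.fullGroup G₁ ≃* CantorSystem.fullGroup G₂)) ∧
    ∀ α : CantorSystem.fullGroup G₁ ≃* CantorSystem.fullGroup G₂,
      ∃ Λ : X₁ ≃ₜ X₂, ∀ g : CantorSystem.fullGroup G₁,
        (α g : X₂ ≃ₜ X₂) = (Λ.symm.trans (g : X₁ ≃ₜ X₁)).trans Λ := by
  obtain ⟨_, _, _⟩ := hX₁.compact_t2_totallyDisconnected
  obtain ⟨_, _, _⟩ := hX₂.compact_t2_totallyDisconnected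
  have spatial : ∀ α : CantorSystem.fullGroup G₁ ≃* CantorSystem.fullGroup G₂,
      ∃ Λ : X₁ ≃ₜ X₂, ∀ g : CantorSystem.fullGroup G₁,
        (α g : X₂ ≃ₜ X₂) = (Λ.symm.trans (g : X₁ ≃ₜ X₁)).trans Λ := by
    intro α
    obtain ⟨Λ, hΛ⟩ := CantorSystem.exists_homeomorph_of_mulEquiv
      (CantorSystem.isAbundantAction_fullGroup horb₁ hinv₁)
      (CantorSystem.isAbundantAction_fullGroup horb₂ hinv₂) α
    refine ⟨Λ, fun g => Homeomorph.ext fun y => ?_⟩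
    obtain ⟨x, rfl⟩ := Λ.surjective y
    have : Λ ((g : X₁ ≃ₜ X₁) x) = (α g : X₂ ≃ₜ X₂) (Λ x) := hΛ g x
    simp [this]
  refine ⟨⟨fun h => h.nonempty_mulEquiv, ?_⟩, spatial⟩
  rintro ⟨α⟩
  obtain ⟨Λ, hΛ⟩ := spatial α
  exact CantorSystem.orbitEquivalent_of_conj α Λ hΛ
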